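/- Let $R$ be a Noetherian integral domain (commutative, $1\neq 0$) and let $M$ be a nonzero torsion-free multiplication $R$-module, i.e. every submodule $N$ of $M$ has the form $N=IM$ for some ideal $I$ of $R$. For a submodule $N$ put $(N:_RM)=\{r\in R: rM\subseteq N\}$. A proper submodule $P$ of $M$ is prime if $am\in P$ ($a\in R$, $m\in M$) implies $m\in P$ or $a\in(P:_RM)$; $M\text{-}\mathrm{rad}(N)$ is the intersection of all prime submodules of $M$ containing $N$ (and is $M$ if there are none). A proper submodule $N$ of $M$ is 2-absorbing primary if, whenever $a,b\in R$, $m\in M$ and $abm\in N$, one has $am\in M\text{-}\mathrm{rad}(N)$ or $bm\in M\text{-}\mathrm{rad}(N)$ or $ab\in(N:_RM)$. The product of submodules $N=IM$ and $K=JM$ is $NK=IJM$, which does not depend on the choice of $I,J$; powers are formed with this product. Let $T$ be the multiplicatively closed set of all $t\in R\setminus\{0\}$ such that $tm=0$ with $m\in M$ implies $m=0$. A submodule $N$ of $M$ is invertible in $M$ if $N'N=M$, where $N'=\{x\in R_T: xN\subseteq M\}$ (the products being formed in $M_T\supseteq M$, and $N'N$ being the set of finite sums of products $xn$ with $x\in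 N'$, $n\in N$). A Dedekind module is a nonzero module all of whose nonzero submodules are invertible in it. Then the following statements are equivalent: 1. $M$ is a Dedekind module. 2. For every nonzero 2-absorbing primary submodule $N$ of $M$, either $N=\mathfrak{M}^{n}$ for some maximal submodule $\mathfrak{M}$ of $M$ and some integer $n\geq 1$, or $N=\mathfrak{M}_1^{n}\mathfrak{M}_2^{m}$ for some maximal submodules $\mathfrak{M}_1,\mathfrak{M}_2$ of $M$ and some integers $n,m\geq 1$. 3. For every nonzero 2-absorbing primary submodule $N$ of $M$, either $N=P^{n}$ for some prime submodule $P$ of $M$ and some integer $n\geq 1$, or $N=P_1^{n}P_2^{m}$ for some prime submodules $P_1,P_2$ of $M$ and some integers $n,m\geq 1$. -/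

import Mathlib

namespace TwoAbsorbing

/-- `M` is a multiplication module: every submodule has the form `I M` for an ideal `I`. -/
def IsMultiplicationModule (R M : Type*) [CommRing R] [AddCommGroup M] [Module R M] : Prop :=
  ∀ N : Submodule R M, ∃ I : Ideal R, N = I • (⊤ : Submodule R M)

/-- The residual `(N :_R M) = {r ∈ R | r M ⊆ N}`. -/
def residual {R M : Type*} [CommRing R] [AddCommGroup M] [Module R M]
    (N : Submodule R M) : Ideal R :=
  N.colon (Set.univ : Set M)

theorem mem_residual {R M : Type*} [CommRing R] [AddCommGroup M] [Module R M]
    {N : Submodule R M} {r : R} : r ∈ residual N ↔ ∀ m : M, r • m ∈ N := by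
  simp [residual, Submodule.mem_colon]

/-- Prime submodules. -/
def IsPrimeSubmodule {R M : Type*} [CommRing R] [AddCommGroup M] [Module R M]
    (N : Submodule R M) : Prop :=
  N ≠ ⊤ ∧ ∀ (a : R) (m : M), a • m ∈ N → m ∈ N ∨ a ∈ residual N

/-- The `M`-radical of `N`: the intersection of all prime submodules of `M` containing `N`
(equal to `M` if there are none). -/
def moduleRadical {R M : Type*} [CommRing R] [AddCommGroup M] [Module R M]
    (N : Submodule R M) : Submodule R M :=
  sInf {P : Submodule R M | IsPrimeSubmodule P ∧ N ≤ P}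

/-- 2-absorbing primary submodules. -/
def IsTwoAbsorbingPrimary {R M : Type*} [CommRing R] [AddCommGroup M] [Module R M]
    (N : Submodule R M) : Prop :=
  N ≠ ⊤ ∧ ∀ (a b : R) (m : M), (a * b) • m ∈ N →
    a • m ∈ moduleRadical N ∨ b • m ∈ moduleRadical N ∨ a * b ∈ residual N

/-- The product `N K = I J M` of submodules `N = I M`, `K = J M` of a multiplication module,
computed from the presentation ideals `I = (N :_R M)`, `J = (K :_R M)`. It does not depend on
the presentation ideals: see `smul_top_submoduleMul`. -/
def submoduleMul {R M : Type*} [CommRing R] [AddCommGroup M] [Module R M]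
    (N K : Submodule R M) : Submodule R M :=
  (residual N * residual K) • (⊤ : Submodule R M)

/-- Powers `N ^ n` for the product of submodules of a multiplication module, with `N ^ 0 = M`. -/
def submodulePow {R M : Type*} [CommRing R] [AddCommGroup M] [Module R M]
    (N : Submodule R M) : ℕ → Submodule R M
  | 0 => ⊤
  | n + 1 => submoduleMul (submodulePow N n) N

theorem residual_smul_top {R M : Type*} [CommRing R] [AddCommGroup M] [Module R M]
    (I : Ideal R) :
    residual (I • (⊤ : Submodule R M)) • (⊤ : Submodule R M) = I • (⊤ : Submodule R M) := by
  apply le_antisymm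
  · rw [Submodule.smul_le]
    exact fun r hr m _ => mem_residual.1 hr m
  · exact Submodule.smul_mono_left fun r hr =>
      mem_residual.2 fun m => Submodule.smul_mem_smul hr Submodule.mem_top

theorem smul_top_submoduleMul {R M : Type*} [CommRing R] [AddCommGroup M] [Module R M]
    (I J : Ideal R) :
    submoduleMul (I • (⊤ : Submodule R M)) (J • (⊤ : Submodule R M)) =
      (I * J) • (⊤ : Submodule R M) := by
  unfold submoduleMul
  rw [Submodule.mul_smul, residual_smul_top, ← Submodule.mul_smul, mul_comm,
    Submodule.mul_smul, residual_smul_top, ← Submodule.mul_smul, mul_comm]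

theorem smul_top_submodulePow {R M : Type*} [CommRing R] [AddCommGroup M] [Module R M]
    (I : Ideal R) (n : ℕ) :
    submodulePow (I • (⊤ : Submodule R M)) n = (I ^ n) • (⊤ : Submodule R M) := by
  induction n with
  | zero => simp [submodulePow]
  | succ n ih => rw [submodulePow, ih, smul_top_submoduleMul, pow_succ]

/-- The multiplicatively closed set
`T = {t ∈ R ∖ {0} | t m = 0 for some m ∈ M implies m = 0}`. -/
def regularScalars (R M : Type*) [CommRing R] [IsDomain R] [AddCommGroup M] [Module R M] :
    Submonoid R where
  carrier := {t | t ≠ 0 ∧ ∀ m : M, t • m = 0 → m = 0}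
  one_mem' := ⟨one_ne_zero, fun m hm => by simpa using hm⟩
  mul_mem' := by
    rintro a b ⟨ha, ha'⟩ ⟨hb, hb'⟩
    exact ⟨mul_ne_zero ha hb, fun m hm => hb' m (ha' _ (by rwa [← mul_smul]))⟩

/-- The canonical copy of `M` in `M_T`; the map `M → M_T` is injective by the choice of `T`. -/
noncomputable def localizationImage (R M : Type*) [CommRing R] [IsDomain R] [AddCommGroup M] [Module R M] :
    Submodule R (LocalizedModule (regularScalars R M) M) :=
  LinearMap.range (LocalizedModule.mkLinearMap (regularScalars R M) M)

theorem mkLinearMap_regularScalars_injective (R M : Type*) [CommRing R] [IsDomain R]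
    [AddCommGroup M] [Module R M] :
    Function.Injective (LocalizedModule.mkLinearMap (regularScalars R M) M) := by
  rw [← LinearMap.ker_eq_bot, LinearMap.ker_eq_bot']
  intro m hm
  obtain ⟨c, hc⟩ := (IsLocalizedModule.eq_zero_iff (regularScalars R M)
    (LocalizedModule.mkLinearMap (regularScalars R M) M)).1 hm
  exact c.2.2 m hc

/-- `N' = {x ∈ R_T | x N ⊆ M}`, where `x N` is formed inside `M_T`. -/
def fractionalResidual {R M : Type*} [CommRing R] [IsDomain R] [AddCommGroup M] [Module R M]
    (N : Submodule R M) : Set (Localization (regularScalars R M)) :=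
  {x | ∀ n ∈ N, x • LocalizedModule.mkLinearMap (regularScalars R M) M n ∈ localizationImage R M}

/-- `N` is invertible in `M`: `N' N = M`, where `N' N` is the set of finite sums of products
`x n` with `x ∈ N'`, `n ∈ N`, formed inside `M_T`. -/
def IsInvertibleSubmodule {R M : Type*} [CommRing R] [IsDomain R] [AddCommGroup M] [Module R M]
    (N : Submodule R M) : Prop :=
  Submodule.span R
    {y : LocalizedModule (regularScalars R M) M | ∃ x ∈ fractionalResidual N, ∃ n ∈ N,
      y = x • LocalizedModule.mkLinearMap (regularScalars R M) M n} = localizationImage R M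

/-- Dedekind modules: nonzero modules all of whose nonzero submodules are invertible. -/
def IsDedekindModule (R M : Type*) [CommRing R] [IsDomain R] [AddCommGroup M] [Module R M] :
    Prop :=
  Nontrivial M ∧ ∀ N : Submodule R M, N ≠ ⊥ → IsInvertibleSubmodule N

end TwoAbsorbing

namespace TwoAbsorbing

/-! A torsion-free multiplication module satisfies `(IM : M) = I`, so `I ↦ IM` is an isomorphism
between the lattices of ideals and submodules (`idealOrderIso`), compatible with products.
Invertibility of `IM` becomes divisibility of a nonzero principal ideal by `I`, so `M` is a Dedekind
module iff `R` is a Dedekind domain (fields included).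

Over a Dedekind domain, `I` is a product of prime powers. Three distinct primes would violate the
2-absorbing condition (`not_isTwoAbsorbingPrimary_of_eq_mul`), so at most two occur. Conversely,
every ideal `I` between `m ^ 2` and a maximal `m` gives a 2-absorbing primary `IM`. A prime
containing `I` equals `m`, so the assumed factorization forces `I = m` or `I = m ^ 2`. With no ideal
strictly between, Nakayama makes each localization at a nonzero maximal ideal a DVR. -/

/-! ### Criteria for a domain to be Dedekind -/

/-- The localization of a Noetherian domain at a nonzero maximal ideal `m` is a discrete valuation
ring if no ideal lies strictly between `m ^ 2` and `m`. -/
theorem isDiscreteValuationRing_localization_of_no_ideal_between {R : Type*} [CommRing R]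
    [IsDomain R] [IsNoetherianRing R] {m : Ideal R} [hm : m.IsMaximal] (hm0 : m ≠ ⊥)
    (h : ∀ I : Ideal R, m ^ 2 ≤ I → I ≤ m → I = m ∨ I = m ^ 2) :
    IsDiscreteValuationRing (Localization.AtPrime m) := by
  have hfield := IsLocalization.AtPrime.not_isField R hm0 (Localization.AtPrime m)
  have : IsNoetherianRing (Localization.AtPrime m) :=
    IsLocalization.isNoetherianRing m.primeCompl _ inferInstance
  obtain ⟨x, hx, hx2⟩ : ∃ x ∈ m, x ∉ m ^ 2 := by
    -- Otherwise `m = m ^ 2`, and a finitely generated idempotent ideal of a domain is `0` or the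
    -- whole ring.
    by_contra! hc
    have hidem : IsIdempotentElem m :=
      le_antisymm Ideal.mul_le_left fun y hy => by simpa [pow_two] using hc y hy
    rcases (Ideal.isIdempotentElem_iff_eq_bot_or_top m (IsNoetherian.noetherian m)).1 hidem with
      h0 | h1
    · exact hm0 h0
    · exact hm.ne_top h1
  have hxm : Ideal.span {x} ≤ m := (Ideal.span_singleton_le_iff_mem m).2 hx
  have hsup : m ^ 2 ⊔ Ideal.span {x} = m := by
    refine (h _ le_sup_left (sup_le (Ideal.pow_le_self two_ne_zero) hxm)).resolve_right ?_
    exact fun h2 => hx2 (h2 ▸ Ideal.mem_sup_right (Ideal.mem_span_singleton_self x))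
  refine ((IsDiscreteValuationRing.TFAE _ hfield).out 0 4).2 ?_
  have hmap := congrArg (Ideal.map (algebraMap R (Localization.AtPrime m))) hsup
  rw [Ideal.map_sup, Ideal.map_pow, Ideal.map_span, Set.image_singleton,
    Localization.AtPrime.map_eq_maximalIdeal] at hmap
  refine ⟨⟨algebraMap R _ x, le_antisymm ?_ ?_⟩⟩
  -- Nakayama: `x` generates the maximal ideal modulo its square, hence generates it.
  · refine Submodule.le_of_le_smul_of_le_jacobson_bot
      (I := IsLocalRing.maximalIdeal (Localization.AtPrime m)) (IsNoetherian.noetherian _)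
      (IsLocalRing.jacobson_eq_maximalIdeal ⊥ bot_ne_top).ge ?_
    rw [smul_eq_mul, ← pow_two, sup_comm]
    exact hmap.ge
  · exact le_sup_right.trans hmap.le

/-- A Noetherian domain is a Dedekind domain if no ideal lies strictly between `m ^ 2` and `m` for
any nonzero maximal ideal `m`. -/
theorem isDedekindDomain_of_no_ideal_between {R : Type*} [CommRing R] [IsDomain R]
    [IsNoetherianRing R]
    (h : ∀ m : Ideal R, m.IsMaximal → m ≠ ⊥ →
      ∀ I : Ideal R, m ^ 2 ≤ I → I ≤ m → I = m ∨ I = m ^ 2) :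
    IsDedekindDomain R := by
  have hmax : ∀ p : Ideal R, p ≠ ⊥ → p.IsPrime → p.IsMaximal := by
    intro p hp0 hp
    obtain ⟨q, hq, hpq⟩ := p.exists_le_maximal hp.ne_top
    have hq0 := ne_bot_of_le_ne_bot hp0 hpq
    have hdvr := isDiscreteValuationRing_localization_of_no_ideal_between hq0 (h q hq hq0)
    have hinj : Function.Injective (algebraMap R (Localization.AtPrime q)) :=
      IsLocalization.injective _ q.primeCompl_le_nonZeroDivisors
    -- `p` and `q` both survive as nonzero primes of the DVR at `q`, which has only one.
    let f := (IsLocalization.orderIsoOfPrime q.primeCompl (Localization.AtPrime q)).symm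
    let p' := f ⟨p, hp, hpq.disjoint_compl_left⟩
    let q' := f ⟨q, hq.isPrime, Set.disjoint_left.mpr fun _ a => a⟩
    have hp1 : p'.1 ≠ ⊥ := fun x => hp0 ((p.map_eq_bot_iff_of_injective hinj).mp x)
    have hq1 : q'.1 ≠ ⊥ := fun x => hq0 ((q.map_eq_bot_iff_of_injective hinj).mp x)
    obtain ⟨_, huq⟩ := (IsDiscreteValuationRing.iff_pid_with_one_nonzero_prime _).mp hdvr
    rwa [show p = q from Subtype.val_inj.mpr <| f.injective <|
      Subtype.val_inj.mp (huq.unique ⟨hp1, p'.2⟩ ⟨hq1, q'.2⟩)]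
  have : IsDedekindDomainDvr R :=
    { is_dvr_at_nonzero_prime := fun p hp0 hp => by
        have := hmax p hp0 hp
        exact isDiscreteValuationRing_localization_of_no_ideal_between hp0 (h p this hp0) }
  infer_instance

/-- An integral domain in which every nonzero ideal divides a nonzero principal ideal is a
Dedekind domain. -/
theorem isDedekindDomain_of_exists_mul_eq_span {R : Type*} [CommRing R] [IsDomain R]
    (h : ∀ I : Ideal R, I ≠ ⊥ → ∃ (J : Ideal R) (a : R), a ≠ 0 ∧ I * J = Ideal.span {a}) :
    IsDedekindDomain R := by
  rw [isDedekindDomain_iff_mul_inv_cancel (K := FractionRing R)]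
  intro F hF
  obtain ⟨b, I, hb, rfl⟩ := FractionalIdeal.exists_eq_spanSingleton_mul F
  have hI : I ≠ ⊥ := by
    rintro rfl
    simp at hF
  obtain ⟨J, a, ha, hIJ⟩ := h I hI
  rw [FractionalIdeal.mul_inv_cancel_iff]
  have hinj := IsFractionRing.injective R (FractionRing R)
  have hb' : algebraMap R (FractionRing R) b ≠ 0 := by simpa using hb
  have ha' : algebraMap R (FractionRing R) a ≠ 0 := by simpa using ha
  refine ⟨FractionalIdeal.spanSingleton _ (algebraMap R _ b) *
    (FractionalIdeal.spanSingleton _ (algebraMap R _ a)⁻¹ *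
      (J : FractionalIdeal (nonZeroDivisors R) (FractionRing R))), ?_⟩
  calc _ = (FractionalIdeal.spanSingleton _ (algebraMap R (FractionRing R) b)⁻¹ *
      FractionalIdeal.spanSingleton _ (algebraMap R _ b)) *
      (FractionalIdeal.spanSingleton _ (algebraMap R (FractionRing R) a)⁻¹ *
        ((I : FractionalIdeal (nonZeroDivisors R) (FractionRing R)) *
          (J : FractionalIdeal (nonZeroDivisors R) (FractionRing R)))) := by ring
    _ = 1 := by
      rw [← FractionalIdeal.coeIdeal_mul, hIJ, FractionalIdeal.coeIdeal_span_singleton,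
        FractionalIdeal.spanSingleton_mul_spanSingleton,
        FractionalIdeal.spanSingleton_mul_spanSingleton, inv_mul_cancel₀ hb', inv_mul_cancel₀ ha']
      simp

/-! ### Ideals of `R` and submodules of `M` -/

theorem smul_mem_smul_top {R M : Type*} [CommRing R] [AddCommGroup M] [Module R M] {I : Ideal R}
    {a : R} (ha : a ∈ I) (m : M) : a • m ∈ I • (⊤ : Submodule R M) :=
  Submodule.smul_mem_smul ha Submodule.mem_top

theorem residual_smul_top_eq_self {R M : Type*} [CommRing R] [AddCommGroup M] [Module R M]
    (hM : IsMultiplicationModule R M) (N : Submodule R M) :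
    residual N • (⊤ : Submodule R M) = N := by
  obtain ⟨I, rfl⟩ := hM N
  exact residual_smul_top I

/-- The residuals of the cyclic submodules of a torsion-free multiplication module generate the
unit ideal. -/
theorem iSup_residual_span_singleton {R M : Type*} [CommRing R] [IsDomain R] [AddCommGroup M]
    [Module R M] [Nontrivial M] [Module.IsTorsionFree R M] (hM : IsMultiplicationModule R M) :
    ⨆ m : M, residual (Submodule.span R {m}) = ⊤ := by
  set θ : Ideal R := ⨆ m : M, residual (Submodule.span R {m})
  have htop : θ • (⊤ : Submodule R M) = ⊤ := by
    refine eq_top_iff.2 fun m _ => ?_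
    have hm : m ∈ residual (Submodule.span R {m}) • (⊤ : Submodule R M) := by
      rw [residual_smul_top_eq_self hM]
      exact Submodule.mem_span_singleton_self m
    exact Submodule.smul_mono_left
      (le_iSup (fun m : M => residual (Submodule.span R {m})) m) hm
  obtain ⟨m, hm⟩ := exists_ne (0 : M)
  -- With `K = (Rm : M)`: `Rm = KM = KθM = θ(Rm)`. Hence `m = sm` with `s ∈ θ`, and torsion-freeness
  -- gives `s = 1`.
  have hmem : m ∈ θ • Submodule.span R {m} := by
    rw [← residual_smul_top_eq_self hM (Submodule.span R {m}), ← Submodule.mul_smul, mul_comm,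
      Submodule.mul_smul, htop, residual_smul_top_eq_self hM]
    exact Submodule.mem_span_singleton_self m
  obtain ⟨s, hs, hsm⟩ := Submodule.mem_smul_span_singleton.1 hmem
  have h1 : s = 1 := smul_left_injective R hm (by simpa using hsm)
  exact (Ideal.eq_top_iff_one θ).2 (h1 ▸ hs)

/-- Cancellation: a torsion-free multiplication module over a domain satisfies `(I M : M) = I`. -/
theorem residual_smul_top_eq {R M : Type*} [CommRing R] [IsDomain R] [AddCommGroup M]
    [Module R M] [Nontrivial M] [Module.IsTorsionFree R M] (hM : IsMultiplicationModule R M)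
    (I : Ideal R) : residual (I • (⊤ : Submodule R M)) = I := by
  refine le_antisymm (fun a ha => ?_) fun a ha => mem_residual.2 fun m => smul_mem_smul_top ha m
  -- It suffices that `a` multiplies each `(Rm : M)` into `I`, since these sum to the unit ideal.
  -- For `r ∈ (Rm : M)`, `ram ∈ rIM ⊆ I(Rm)`, and a nonzero `m` can be cancelled.
  have hle : ⨆ m : M, residual (Submodule.span R {m}) ≤ Submodule.comap (LinearMap.mulLeft R a) I := by
    refine iSup_le fun m r hr => ?_
    change a * r ∈ I
    rw [mem_residual] at ha hr
    rcases eq_or_ne m 0 with rfl | hm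
    · obtain ⟨x, hx⟩ := exists_ne (0 : M)
      have : r • x = 0 := by simpa using hr x
      rw [(smul_eq_zero.1 this).resolve_right hx, mul_zero]
      exact I.zero_mem
    · have hmap : I • (⊤ : Submodule R M) ≤
          (I • Submodule.span R {m}).comap (LinearMap.lsmul R M r) := by
        refine Submodule.smul_le.2 fun i hi x _ => ?_
        change r • i • x ∈ I • Submodule.span R {m}
        rw [smul_comm]
        exact Submodule.smul_mem_smul hi (hr x)
      have hmem : r • a • m ∈ I • Submodule.span R {m} := hmap (ha m)
      obtain ⟨j, hj, hjm⟩ := Submodule.mem_smul_span_singleton.1 hmem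
      rw [smul_smul] at hjm
      rw [mul_comm, ← smul_left_injective R hm hjm]
      exact hj
  rw [iSup_residual_span_singleton hM] at hle
  simpa using hle (Submodule.mem_top (x := (1 : R)))

/-- The lattice of submodules of a torsion-free multiplication module over a domain is that of the
ideals of the ring. -/
def idealOrderIso {R M : Type*} [CommRing R] [IsDomain R] [AddCommGroup M]
    [Module R M] [Nontrivial M] [Module.IsTorsionFree R M] (hM : IsMultiplicationModule R M) :
    Ideal R ≃o Submodule R M where
  toFun I := I • ⊤
  invFun := residual
  left_inv := residual_smul_top_eq hM
  right_inv := residual_smul_top_eq_self hM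
  map_rel_iff' {I J} := by
    refine ⟨fun h => ?_, fun h => Submodule.smul_mono_left h⟩
    rw [← residual_smul_top_eq hM J]
    exact fun a ha => mem_residual.2 fun m => h (smul_mem_smul_top ha m)

theorem isPrimeSubmodule_of_isCoatom {R M : Type*} [CommRing R] [AddCommGroup M] [Module R M]
    {P : Submodule R M} (hP : IsCoatom P) : IsPrimeSubmodule P := by
  refine ⟨hP.1, fun a m ham => or_iff_not_imp_left.2 fun hm => mem_residual.2 fun y => ?_⟩
  have hsup : P ⊔ Submodule.span R {m} = ⊤ :=
    hP.2 _ (lt_of_le_of_ne le_sup_left fun h =>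
      hm (h ▸ Submodule.mem_sup_right (Submodule.mem_span_singleton_self m)))
  obtain ⟨p, hp, z, hz, rfl⟩ := Submodule.mem_sup.1 (hsup ▸ Submodule.mem_top (x := y))
  obtain ⟨r, rfl⟩ := Submodule.mem_span_singleton.1 hz
  rw [smul_add, smul_comm a r]
  exact P.add_mem (P.smul_mem a hp) (P.smul_mem r ham)

theorem isPrime_residual {R M : Type*} [CommRing R] [AddCommGroup M] [Module R M]
    {P : Submodule R M} (hP : IsPrimeSubmodule P) : (residual P).IsPrime := by
  refine ⟨fun h => hP.1 (eq_top_iff.2 fun m _ => ?_), fun {a b} hab => ?_⟩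
  · simpa using mem_residual.1 ((Ideal.eq_top_iff_one _).1 h) m
  · refine or_iff_not_imp_left.2 fun ha => mem_residual.2 fun m => ?_
    refine (hP.2 a (b • m) ?_).resolve_right ha
    rw [smul_smul]
    exact mem_residual.1 hab m

theorem isCoatom_smul_top {R M : Type*} [CommRing R] [IsDomain R] [AddCommGroup M]
    [Module R M] [Nontrivial M] [Module.IsTorsionFree R M] (hM : IsMultiplicationModule R M)
    {m : Ideal R} (hm : m.IsMaximal) : IsCoatom (m • (⊤ : Submodule R M)) :=
  ((idealOrderIso hM).isCoatom_iff m).2 hm.out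

/-! ### Invertible submodules and invertible ideals -/

theorem smul_mk_smul {R M : Type*} [CommRing R] [AddCommGroup M] [Module R M]
    {S : Submonoid R} (r : R) (t : S) (y : LocalizedModule S M) :
    (t : R) • (Localization.mk r t • y) = r • y := by
  rw [← smul_assoc, Localization.smul_mk, smul_eq_mul, Localization.mk_eq_mk',
    IsLocalization.mk'_mul_cancel_left, algebraMap_smul]

/-- Clears denominators: `t` acts injectively on `M_T`, and `M` embeds in `M_T`. -/
theorem mk_smul_eq_iff {R M : Type*} [CommRing R] [IsDomain R] [AddCommGroup M] [Module R M]
    (r : R) (t : regularScalars R M) (n k : M) :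
    Localization.mk r t • LocalizedModule.mkLinearMap (regularScalars R M) M n =
      LocalizedModule.mkLinearMap (regularScalars R M) M k ↔ r • n = (t : R) • k := by
  rw [← (IsLocalizedModule.smul_injective (LocalizedModule.mkLinearMap (regularScalars R M) M)
    t).eq_iff, ← (mkLinearMap_regularScalars_injective R M).eq_iff, map_smul, map_smul,
    ← smul_mk_smul r t]
  rfl

/-- If `I` is nonzero and `I M` is invertible in `M`, then `I` divides a nonzero principal
ideal. -/
theorem exists_mul_eq_span_of_isInvertibleSubmodule {R M : Type*} [CommRing R] [IsDomain R]
    [AddCommGroup M] [Module R M] [Nontrivial M] [Module.IsTorsionFree R M]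
    (hM : IsMultiplicationModule R M) {I : Ideal R} (hI : I ≠ ⊥)
    (hinv : IsInvertibleSubmodule (I • (⊤ : Submodule R M))) :
    ∃ (J : Ideal R) (a : R), a ≠ 0 ∧ I * J = Ideal.span {a} := by
  obtain ⟨a, haI, ha⟩ := Submodule.exists_mem_ne_zero_of_ne_bot hI
  refine ⟨(Ideal.span {a}).colon (I : Set R), a, ha, le_antisymm ?_ ?_⟩
  · refine Ideal.mul_le.2 fun i hi j hj => ?_
    simpa [mul_comm] using Submodule.mem_colon.1 hj i hi
  set J : Ideal R := (Ideal.span {a}).colon (I : Set R)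
  rw [Ideal.span_singleton_le_iff_mem, ← residual_smul_top_eq hM (I * J), mem_residual]
  intro m
  set ι := LocalizedModule.mkLinearMap (regularScalars R M) M
  have hmul : ∀ x ∈ fractionalResidual (I • (⊤ : Submodule R M)),
      ∀ n ∈ I • (⊤ : Submodule R M), a • x • ι n ∈ ((I * J) • (⊤ : Submodule R M)).map ι := by
    intro x hx n hn
    obtain ⟨⟨r, t⟩, rfl⟩ : ∃ p : R × regularScalars R M, Localization.mk p.1 p.2 = x := by
      induction x using Localization.induction_on with
      | _ p => exact ⟨p, rfl⟩
    -- From `(r/t)IM ⊆ M` follows `rIM ⊆ tM`, and cancellation of `M` gives `rI ⊆ (t)`.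
    have hdvd : ∀ i ∈ I, ∃ j : R, r * i = t * j := by
      intro i hi
      have : r * i ∈ Ideal.span {(t : R)} := by
        rw [← residual_smul_top_eq hM (Ideal.span {(t : R)}), mem_residual]
        intro y
        obtain ⟨k, hk⟩ := hx _ (smul_mem_smul_top hi y)
        rw [mul_smul, (mk_smul_eq_iff r t _ k).1 hk.symm]
        exact smul_mem_smul_top (Ideal.mem_span_singleton_self _) k
      exact Ideal.mem_span_singleton.1 this
    -- `s` is `ax` with `x = r/t`. Thus `aN' ⊆ J`, and `aM = aN'N ⊆ IJM`.
    obtain ⟨s, hs⟩ := hdvd a haI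
    have hsJ : s ∈ J := by
      refine Submodule.mem_colon.2 fun i hi => ?_
      obtain ⟨j, hj⟩ := hdvd i hi
      refine Ideal.mem_span_singleton.2 ⟨j, mul_left_cancel₀ t.2.1 ?_⟩
      rw [smul_eq_mul, ← mul_assoc, ← hs]
      linear_combination a * hj
    refine ⟨s • n, ?_, ?_⟩
    · rw [mul_comm, Submodule.mul_smul]
      exact Submodule.smul_mem_smul hsJ hn
    · rw [smul_comm, ← map_smul]
      refine ((mk_smul_eq_iff r t _ _).2 ?_).symm
      rw [smul_smul, smul_smul, hs]
  have hspan : localizationImage R M ≤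
      (((I * J) • (⊤ : Submodule R M)).map ι).comap (LinearMap.lsmul R _ a) := by
    rw [← hinv, Submodule.span_le]
    rintro _ ⟨x, hx, n, hn, rfl⟩
    exact hmul x hx n hn
  obtain ⟨k, hk, hkm⟩ := hspan ⟨m, rfl⟩
  have : k = a • m := mkLinearMap_regularScalars_injective R M (by rw [map_smul]; exact hkm)
  exact this ▸ hk

/-- If `I` divides a nonzero principal ideal, then `I M` is invertible in `M`. -/
theorem isInvertibleSubmodule_of_mul_eq_span {R M : Type*} [CommRing R] [IsDomain R]
    [AddCommGroup M] [Module R M] [Module.IsTorsionFree R M] {I J : Ideal R} {a : R}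
    (ha : a ≠ 0) (hIJ : I * J = Ideal.span {a}) :
    IsInvertibleSubmodule (I • (⊤ : Submodule R M)) := by
  set ι := LocalizedModule.mkLinearMap (regularScalars R M) M
  let t : regularScalars R M := ⟨a, ha, fun m hm => (smul_eq_zero.1 hm).resolve_left ha⟩
  refine le_antisymm (Submodule.span_le.2 ?_) ?_
  · rintro _ ⟨x, hx, n, hn, rfl⟩
    exact hx n hn
  have hfrac : ∀ j ∈ J,
      Localization.mk j t ∈ fractionalResidual (I • (⊤ : Submodule R M)) := by
    intro j hj n hn
    have hjn : j • n ∈ Ideal.span {a} • (⊤ : Submodule R M) := by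
      rw [← hIJ, mul_comm, Submodule.mul_smul]
      exact Submodule.smul_mem_smul hj hn
    rw [Submodule.ideal_span_singleton_smul] at hjn
    obtain ⟨k, -, hk⟩ := hjn
    exact ⟨k, ((mk_smul_eq_iff j t n k).2 hk.symm).symm⟩
  rintro _ ⟨m, rfl⟩
  -- A general `c` permits induction over sums of products `ji`. Taking `c = a` recovers `m =
  -- (a/a)m`.
  have hmem : ∀ c ∈ J * I, Localization.mk c t • ι m ∈ Submodule.span R
      {y | ∃ x ∈ fractionalResidual (I • (⊤ : Submodule R M)),
        ∃ n ∈ I • (⊤ : Submodule R M), y = x • ι n} := by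
    intro c hc
    refine Submodule.mul_induction_on hc (fun j hj i hi => ?_) fun x y hx hy => ?_
    · refine Submodule.subset_span ⟨_, hfrac j hj, i • m, smul_mem_smul_top hi m, ?_⟩
      apply IsLocalizedModule.smul_injective ι t
      change (t : R) • (Localization.mk (j * i) t • ι m) =
        (t : R) • (Localization.mk j t • ι (i • m))
      rw [smul_mk_smul, smul_mk_smul, map_smul, mul_smul]
    · rw [← Localization.add_mk_self, add_smul]
      exact add_mem hx hy
  have := hmem a (by rw [mul_comm, hIJ]; exact Ideal.mem_span_singleton_self a)
  rwa [(mk_smul_eq_iff a t m m).2 rfl] at this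

/-- Over a Dedekind domain, containing is dividing, so `I` divides `(a)` for any nonzero `a ∈ I`. -/
theorem isDedekindModule_iff_isDedekindDomain {R M : Type*} [CommRing R] [IsDomain R]
    [AddCommGroup M] [Module R M] [Nontrivial M] [Module.IsTorsionFree R M]
    (hM : IsMultiplicationModule R M) : IsDedekindModule R M ↔ IsDedekindDomain R := by
  constructor
  · intro h
    refine isDedekindDomain_of_exists_mul_eq_span fun I hI =>
      exists_mul_eq_span_of_isInvertibleSubmodule hM hI (h.2 _ fun h0 => hI ?_)
    exact (map_eq_bot_iff (idealOrderIso hM)).1 h0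
  · refine fun _ => ⟨inferInstance, fun N hN => ?_⟩
    obtain ⟨I, rfl⟩ := hM N
    have hI : I ≠ ⊥ := by
      rintro rfl
      simp at hN
    obtain ⟨a, haI, ha⟩ := Submodule.exists_mem_ne_zero_of_ne_bot hI
    obtain ⟨J, hJ⟩ := Ideal.dvd_iff_le.2 ((Ideal.span_singleton_le_iff_mem I).2 haI)
    exact isInvertibleSubmodule_of_mul_eq_span ha hJ.symm

/-! ### 2-absorbing primary submodules -/

/-- `M/mM` is a vector space over `R/m`, where `a` acts invertibly. -/
theorem mem_of_smul_mem_maximal_smul_top {R M : Type*} [CommRing R] [AddCommGroup M] [Module R M]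
    {m : Ideal R} (hm : m.IsMaximal) {a : R} (ha : a ∉ m) {x : M}
    (hx : a • x ∈ m • (⊤ : Submodule R M)) : x ∈ m • (⊤ : Submodule R M) := by
  obtain ⟨r, s, hs, hrs⟩ := hm.exists_inv ha
  rw [← one_smul R x, ← hrs, add_smul, mul_smul]
  exact add_mem (Submodule.smul_mem _ r hx) (smul_mem_smul_top hs x)

theorem moduleRadical_le_maximal_smul_top {R M : Type*} [CommRing R] [IsDomain R]
    [AddCommGroup M] [Module R M] [Nontrivial M] [Module.IsTorsionFree R M]
    (hM : IsMultiplicationModule R M) {I m : Ideal R} (hm : m.IsMaximal) (hI : I ≤ m) :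
    moduleRadical (I • (⊤ : Submodule R M)) ≤ m • (⊤ : Submodule R M) :=
  sInf_le ⟨isPrimeSubmodule_of_isCoatom (isCoatom_smul_top hM hm), Submodule.smul_mono_left hI⟩

/-- If `I` lies between `m ^ 2` and the maximal ideal `m`, then `I M` is 2-absorbing primary. -/
theorem isTwoAbsorbingPrimary_of_sq_le {R M : Type*} [CommRing R] [IsDomain R]
    [AddCommGroup M] [Module R M] [Nontrivial M] [Module.IsTorsionFree R M]
    (hM : IsMultiplicationModule R M) {I m : Ideal R} (hm : m.IsMaximal)
    (h1 : m ^ 2 ≤ I) (h2 : I ≤ m) : IsTwoAbsorbingPrimary (I • (⊤ : Submodule R M)) := by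
  -- For a prime `P ⊇ IM`, the prime ideal `(P : M)` contains `m ^ 2`, hence `m`.
  have hle : m • (⊤ : Submodule R M) ≤ moduleRadical (I • (⊤ : Submodule R M)) := by
    refine le_sInf ?_
    rintro P ⟨hP, hIP⟩
    have hres := isPrime_residual hP
    have hIres : I ≤ residual P := fun a ha =>
      mem_residual.2 fun x => hIP (smul_mem_smul_top ha x)
    have hmres : m ≤ residual P := Ideal.IsPrime.le_of_pow_le (h1.trans hIres)
    exact Submodule.smul_le.2 fun a ha x _ => mem_residual.1 (hmres ha) x
  have hsub : I • (⊤ : Submodule R M) ≤ m • (⊤ : Submodule R M) := Submodule.smul_mono_left h2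
  refine ⟨fun h => (isCoatom_smul_top hM hm).1 (top_le_iff.1 (h.ge.trans hsub)), fun a b x hx => ?_⟩
  by_cases ha : a ∈ m
  · exact Or.inl (hle (smul_mem_smul_top ha x))
  by_cases hb : b ∈ m
  · exact Or.inr (Or.inl (hle (smul_mem_smul_top hb x)))
  have hab : a * b ∉ m := fun h => (hm.isPrime.mem_or_mem h).elim ha hb
  exact Or.inl (hle (Submodule.smul_mem _ a (mem_of_smul_mem_maximal_smul_top hm hab (hsub hx))))

/-- If `A`, `B`, `C` are each contained in exactly one of three maximal ideals, a different one for
each, then `(A B C) M` is not 2-absorbing primary. -/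
theorem not_isTwoAbsorbingPrimary_of_eq_mul {R M : Type*} [CommRing R] [IsDomain R]
    [AddCommGroup M] [Module R M] [Nontrivial M] [Module.IsTorsionFree R M]
    (hM : IsMultiplicationModule R M) {P₁ P₂ P₃ A B C : Ideal R} (h₁ : P₁.IsMaximal)
    (h₂ : P₂.IsMaximal) (h₃ : P₃.IsMaximal) (hA₁ : A ≤ P₁) (hA₂ : ¬ A ≤ P₂) (hA₃ : ¬ A ≤ P₃)
    (hB₂ : B ≤ P₂) (hB₁ : ¬ B ≤ P₁) (hB₃ : ¬ B ≤ P₃) (hC₃ : C ≤ P₃) (hC₁ : ¬ C ≤ P₁)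
    (hC₂ : ¬ C ≤ P₂) : ¬ IsTwoAbsorbingPrimary ((A * (B * C)) • (⊤ : Submodule R M)) := by
  have havoid : ∀ {I J K : Ideal R}, ¬ I ≤ J → ¬ I ≤ K → ∃ a ∈ I, a ∉ J ∧ a ∉ K := by
    intro I J K hJ hK
    by_contra! hc
    refine (Ideal.subset_union.1 fun a ha => ?_).elim hJ hK
    exact or_iff_not_imp_left.2 (hc a ha)
  rintro ⟨-, h⟩
  obtain ⟨a, haA, ha₂, ha₃⟩ := havoid hA₂ hA₃
  obtain ⟨b, hbB, hb₁, hb₃⟩ := havoid hB₁ hB₃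
  obtain ⟨c, hcC, hc₁, hc₂⟩ := havoid hC₁ hC₂
  have hle₁ : A * (B * C) ≤ P₁ := Ideal.mul_le_left.trans hA₁
  have hle₂ : A * (B * C) ≤ P₂ := Ideal.mul_le_right.trans (Ideal.mul_le_left.trans hB₂)
  have hle₃ : A * (B * C) ≤ P₃ := Ideal.mul_le_right.trans (Ideal.mul_le_right.trans hC₃)
  -- Applying the condition to `a`, `b` and `cx` puts every `x` in `P₂M` or `P₁M`, because `ab ∉
  -- P₃`. A module is not the union of two proper submodules.
  have hcover : ((⊤ : Submodule R M) : Set M) ⊆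
      (P₂ • (⊤ : Submodule R M) : Submodule R M) ∪ (P₁ • (⊤ : Submodule R M) : Submodule R M) := by
    intro x _
    have hx : (a * b) • c • x ∈ (A * (B * C)) • (⊤ : Submodule R M) := by
      rw [smul_smul, mul_assoc]
      exact smul_mem_smul_top (Ideal.mul_mem_mul haA (Ideal.mul_mem_mul hbB hcC)) x
    rcases h a b _ hx with hac | hbc | hab
    · have := moduleRadical_le_maximal_smul_top hM h₂ hle₂ hac
      exact Or.inl (mem_of_smul_mem_maximal_smul_top h₂ hc₂
        (mem_of_smul_mem_maximal_smul_top h₂ ha₂ this))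
    · have := moduleRadical_le_maximal_smul_top hM h₁ hle₁ hbc
      exact Or.inr (mem_of_smul_mem_maximal_smul_top h₁ hc₁
        (mem_of_smul_mem_maximal_smul_top h₁ hb₁ this))
    · rw [residual_smul_top_eq hM] at hab
      exact ((h₃.isPrime.mem_or_mem (hle₃ hab)).elim ha₃ hb₃).elim
  rcases AddSubgroupClass.subset_union.1 hcover with h | h
  · exact (isCoatom_smul_top hM h₂).1 (top_le_iff.1 h)
  · exact (isCoatom_smul_top hM h₁).1 (top_le_iff.1 h)

/-- Over a Dedekind domain, if `I M` is 2-absorbing primary and `I ≠ 0`, then `I` is a power of a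
maximal ideal or a product of two such powers. -/
theorem exists_eq_pow_of_isTwoAbsorbingPrimary {R M : Type*} [CommRing R] [IsDedekindDomain R]
    [AddCommGroup M] [Module R M] [Nontrivial M] [Module.IsTorsionFree R M]
    (hM : IsMultiplicationModule R M) {I : Ideal R} (hI : I ≠ ⊥)
    (h : IsTwoAbsorbingPrimary (I • (⊤ : Submodule R M))) :
    (∃ (P : Ideal R) (n : ℕ), P.IsMaximal ∧ 1 ≤ n ∧ I = P ^ n) ∨
      ∃ (P₁ P₂ : Ideal R) (n m : ℕ), P₁.IsMaximal ∧ P₂.IsMaximal ∧ 1 ≤ n ∧ 1 ≤ m ∧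
        I = P₁ ^ n * P₂ ^ m := by
  classical
  set F := UniqueFactorizationMonoid.normalizedFactors I
  have hprime : ∀ P ∈ F.toFinset, P.IsPrime ∧ P ≠ ⊥ := by
    intro P hP
    have := UniqueFactorizationMonoid.prime_of_normalized_factor P (Multiset.mem_toFinset.1 hP)
    exact ⟨Ideal.isPrime_of_prime this, this.ne_zero⟩
  have hmax : ∀ P ∈ F.toFinset, P.IsMaximal := fun P hP =>
    (hprime P hP).1.isMaximal (hprime P hP).2
  have hcount : ∀ P ∈ F.toFinset, 1 ≤ F.count P := fun P hP =>
    Multiset.one_le_count_iff_mem.2 (Multiset.mem_toFinset.1 hP)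
  have hprod : I = ∏ P ∈ F.toFinset, P ^ F.count P := by
    rw [← Finset.prod_multiset_count, Ideal.prod_normalizedFactors_eq_self hI]
  have hle : ∀ P ∈ F.toFinset, ∀ Q ∈ F.toFinset, P ^ F.count P ≤ Q → P = Q := by
    intro P hP Q hQ hPQ
    have := (hprime Q hQ).1
    exact (hmax P hP).eq_of_le (hprime Q hQ).1.ne_top (Ideal.IsPrime.le_of_pow_le hPQ)
  have hself : ∀ P ∈ F.toFinset, P ^ F.count P ≤ P := fun P hP =>
    Ideal.pow_le_self (Nat.one_le_iff_ne_zero.1 (hcount P hP))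
  have hcard : F.toFinset.card ≤ 2 := by
    by_contra! hc
    obtain ⟨P₁, m₁, P₂, m₂, P₃, m₃, h₁₂, h₁₃, h₂₃⟩ := Finset.two_lt_card.1 hc
    have m₂' : P₂ ∈ F.toFinset.erase P₁ := Finset.mem_erase.2 ⟨h₁₂.symm, m₂⟩
    -- The third factor collects all primes other than `P₁` and `P₂`, so more than three primes need
    -- no separate case.
    have m₃' : P₃ ∈ (F.toFinset.erase P₁).erase P₂ :=
      Finset.mem_erase.2 ⟨h₂₃.symm, Finset.mem_erase.2 ⟨h₁₃.symm, m₃⟩⟩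
    rw [hprod, ← Finset.mul_prod_erase _ _ m₁, ← Finset.mul_prod_erase _ _ m₂'] at h
    have hrest : ∀ Q ∈ F.toFinset, Q = P₁ ∨ Q = P₂ →
        ¬ ∏ P ∈ (F.toFinset.erase P₁).erase P₂, P ^ F.count P ≤ Q := by
      intro Q hQ hQ' hc
      obtain ⟨P, hP, hPQ⟩ := (hprime Q hQ).1.prod_le.1 hc
      simp only [Finset.mem_erase] at hP
      have := hle P hP.2.2 Q hQ hPQ
      grind
    refine not_isTwoAbsorbingPrimary_of_eq_mul hM (hmax _ m₁) (hmax _ m₂) (hmax _ m₃)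
      (hself _ m₁) (mt (hle _ m₁ _ m₂) h₁₂) (mt (hle _ m₁ _ m₃) h₁₃)
      (hself _ m₂) (mt (hle _ m₂ _ m₁) h₁₂.symm) (mt (hle _ m₂ _ m₃) h₂₃)
      ?_ (hrest _ m₁ (Or.inl rfl)) (hrest _ m₂ (Or.inr rfl)) h
    rw [← Finset.mul_prod_erase _ _ m₃']
    exact Ideal.mul_le_left.trans (hself _ m₃)
  have hcases : F.toFinset.card = 0 ∨ F.toFinset.card = 1 ∨ F.toFinset.card = 2 := by lia
  rcases hcases with h0 | h1 | h2
  · rw [Finset.card_eq_zero.1 h0, Finset.prod_empty] at hprod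
    exact (h.1 (by rw [hprod, one_smul])).elim
  · obtain ⟨P, hP⟩ := Finset.card_eq_one.1 h1
    have hPm : P ∈ F.toFinset := hP ▸ Finset.mem_singleton_self P
    rw [hP, Finset.prod_singleton] at hprod
    exact Or.inl ⟨P, _, hmax P hPm, hcount P hPm, hprod⟩
  · obtain ⟨P, Q, hne, hPQ⟩ := Finset.card_eq_two.1 h2
    have hPm : P ∈ F.toFinset := by simp [hPQ]
    have hQm : Q ∈ F.toFinset := by simp [hPQ]
    rw [hPQ, Finset.prod_pair hne] at hprod
    exact Or.inr ⟨P, Q, _, _, hmax P hPm, hmax Q hQm, hcount P hPm, hcount Q hQm, hprod⟩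

/-- An ideal between `m ^ 2` and the maximal ideal `m` that is a product of positive powers of at
most two primes is `m` or `m ^ 2`. -/
theorem eq_or_eq_sq_of_eq_pow {R : Type*} [CommRing R] {I m : Ideal R} (hm : m.IsMaximal)
    (h1 : m ^ 2 ≤ I) (h2 : I ≤ m)
    (h : (∃ (P : Ideal R) (n : ℕ), P.IsPrime ∧ 1 ≤ n ∧ I = P ^ n) ∨
      ∃ (P₁ P₂ : Ideal R) (n k : ℕ), P₁.IsPrime ∧ P₂.IsPrime ∧ 1 ≤ n ∧ 1 ≤ k ∧
        I = P₁ ^ n * P₂ ^ k) :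
    I = m ∨ I = m ^ 2 := by
  have hprime : ∀ P : Ideal R, P.IsPrime → I ≤ P → P = m := fun P hP hIP =>
    (hm.eq_of_le hP.ne_top (Ideal.IsPrime.le_of_pow_le (h1.trans hIP))).symm
  obtain ⟨k, hk, rfl⟩ : ∃ k : ℕ, 1 ≤ k ∧ I = m ^ k := by
    rcases h with ⟨P, n, hP, hn, rfl⟩ | ⟨P, Q, n, k, hP, hQ, hn, hk, rfl⟩
    · exact ⟨n, hn, by rw [hprime P hP (Ideal.pow_le_self (by lia))]⟩
    · refine ⟨n + k, by lia, ?_⟩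
      rw [hprime P hP (Ideal.mul_le_left.trans (Ideal.pow_le_self (by lia))),
        hprime Q hQ (Ideal.mul_le_right.trans (Ideal.pow_le_self (by lia))), pow_add]
  rcases hk.eq_or_lt with rfl | hk
  · exact Or.inl (pow_one m)
  -- Here `k ≥ 2`, so `m ^ k ≤ m ^ 2 ≤ I = m ^ k`.
  · exact Or.inr (le_antisymm (Ideal.pow_le_pow_right hk) h1)

end TwoAbsorbing

/-! ### The equivalence -/

theorem mainTheorem4 {R M : Type*} [CommRing R] [IsDomain R] [IsNoetherianRing R]
    [AddCommGroup M] [Module R M] [Nontrivial M] [Module.IsTorsionFree R M]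
    (hM : TwoAbsorbing.IsMultiplicationModule R M) :
    List.TFAE [
      TwoAbsorbing.IsDedekindModule R M,
      ∀ N : Submodule R M, N ≠ ⊥ → TwoAbsorbing.IsTwoAbsorbingPrimary N →
        (∃ (P : Submodule R M) (n : ℕ), IsCoatom P ∧ 1 ≤ n ∧
          N = TwoAbsorbing.submodulePow P n) ∨
        (∃ (P₁ P₂ : Submodule R M) (n m : ℕ), IsCoatom P₁ ∧ IsCoatom P₂ ∧ 1 ≤ n ∧ 1 ≤ m ∧
          N = TwoAbsorbing.submoduleMul (TwoAbsorbing.submodulePow P₁ n)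
            (TwoAbsorbing.submodulePow P₂ m)),
      ∀ N : Submodule R M, N ≠ ⊥ → TwoAbsorbing.IsTwoAbsorbingPrimary N →
        (∃ (P : Submodule R M) (n : ℕ), TwoAbsorbing.IsPrimeSubmodule P ∧ 1 ≤ n ∧
          N = TwoAbsorbing.submodulePow P n) ∨
        (∃ (P₁ P₂ : Submodule R M) (n m : ℕ), TwoAbsorbing.IsPrimeSubmodule P₁ ∧
          TwoAbsorbing.IsPrimeSubmodule P₂ ∧ 1 ≤ n ∧ 1 ≤ m ∧
          N = TwoAbsorbing.submoduleMul (TwoAbsorbing.submodulePow P₁ n)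
            (TwoAbsorbing.submodulePow P₂ m))] := by
  open TwoAbsorbing in
  tfae_have 1 → 2 := by
    intro h N hN hN2
    have := (isDedekindModule_iff_isDedekindDomain hM).1 h
    obtain ⟨I, rfl⟩ := hM N
    have hI : I ≠ ⊥ := by
      rintro rfl
      simp at hN
    rcases exists_eq_pow_of_isTwoAbsorbingPrimary hM hI hN2 with
      ⟨P, n, hP, hn, rfl⟩ | ⟨P, Q, n, m, hP, hQ, hn, hm, rfl⟩
    · exact Or.inl ⟨_, n, isCoatom_smul_top hM hP, hn, (smul_top_submodulePow P n).symm⟩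
    · refine Or.inr ⟨_, _, n, m, isCoatom_smul_top hM hP, isCoatom_smul_top hM hQ, hn, hm, ?_⟩
      rw [smul_top_submodulePow, smul_top_submodulePow, smul_top_submoduleMul]
  open TwoAbsorbing in
  tfae_have 2 → 3 := by
    intro h N hN hN2
    rcases h N hN hN2 with ⟨P, n, hP, hn, hPn⟩ | ⟨P, Q, n, m, hP, hQ, hn, hm, hPQ⟩
    · exact Or.inl ⟨P, n, isPrimeSubmodule_of_isCoatom hP, hn, hPn⟩
    · exact Or.inr ⟨P, Q, n, m, isPrimeSubmodule_of_isCoatom hP, isPrimeSubmodule_of_isCoatom hQ,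
        hn, hm, hPQ⟩
  open TwoAbsorbing in
  tfae_have 3 → 1 := by
    intro h
    rw [isDedekindModule_iff_isDedekindDomain hM]
    refine isDedekindDomain_of_no_ideal_between fun m hm hm0 I h1 h2 =>
      eq_or_eq_sq_of_eq_pow hm h1 h2 ?_
    have hI : I ≠ ⊥ := ne_bot_of_le_ne_bot (pow_ne_zero 2 hm0) h1
    have hIM : I • (⊤ : Submodule R M) ≠ ⊥ := mt (map_eq_bot_iff (idealOrderIso hM)).1 hI
    have hinj : ∀ J : Ideal R, I • (⊤ : Submodule R M) = J • (⊤ : Submodule R M) → I = J :=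
      fun J hJ => (idealOrderIso hM).injective hJ
    rcases h _ hIM (isTwoAbsorbingPrimary_of_sq_le hM hm h1 h2) with
      ⟨P, n, hP, hn, hPn⟩ | ⟨P, Q, n, k, hP, hQ, hn, hk, hPQ⟩
    -- Writing `P = (P : M)M` turns the factorization of `IM` into one of `I` by prime ideals.
    · refine Or.inl ⟨residual P, n, isPrime_residual hP, hn, hinj _ ?_⟩
      rw [hPn, ← smul_top_submodulePow, residual_smul_top_eq_self hM]
    · refine Or.inr ⟨residual P, residual Q, n, k, isPrime_residual hP, isPrime_residual hQ, hn,
        hk, hinj _ ?_⟩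
      rw [hPQ, ← smul_top_submoduleMul, ← smul_top_submodulePow, ← smul_top_submodulePow,
        residual_smul_top_eq_self hM, residual_smul_top_eq_self hM]
  tfae_finish
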